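/- For $\alpha\in\mathbb R$ let $\mathbb A_\alpha$ be the noncommutative $2$-torus, i.e. the universal unital $C^*$-algebra generated by two unitaries $U,V$ with $UV=e^{2\pi i\alpha}VU$. Let $\mathbb T$ be the unit circle with normalised Haar measure $\mathrm m$. For $\theta\in\mathbb R$ and a continuous $f:\mathbb T\to\mathbb T$ let $\Phi=\Phi_{\theta,f}$ be the $*$-automorphism of $\mathbb A_\alpha$ determined by $\Phi(U)=e^{i\theta}U$ and $\Phi(V)=f(U)V$. For $n\in\mathbb Z$ and $z\in\mathbb T$ put $$f_n(z)=\prod_{l=0}^{n-1}f(e^{-2\pi i l\alpha}z)\ (n>0),\qquad f_0(z)=1,\qquad f_n(z)=\prod_{l=1}^{|n|}\overline{f(e^{2\pi i l\alpha}z)}\ (n<0).$$ Suppose that $\theta/2\pi$ is irrational and that for some $n\in\mathbb Z\smallsetminus\{0\}$ the cohomological equation $$g(e^{i\theta}z)\,f_n(z)=g(z)\qquad\text{for }\mathrm m\text{-a.e. }z\in\mathbb T$$ has a solution $g\in L^2(\mathbb T,\mathrm m)\smallsetminus C(\mathbb T)$, that is, a solution that is not $\mathrm m$-a.e. equal to a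 continuous function. Then: (1) there is $a\in\mathbb A_\alpha$ such that the Cesàro means $\frac1N\sum_{k=0}^{N-1}\Phi^k(a)$ have no limit in $\mathbb A_\alpha$, as $N\to\infty$, in the weak topology $\sigma(\mathbb A_\alpha,\mathbb A_\alpha^*)$; (2) consequently the $C^*$-dynamical system $(\mathbb A_\alpha,\Phi)$ is not uniquely ergodic with respect to its fixed-point subalgebra $\mathbb A_\alpha^\Phi=\{x:\Phi(x)=x\}$: it is not the case that $\frac1N\sum_{k=0}^{N-1}\Phi^k(a)$ converges in norm for every $a\in\mathbb A_\alpha$, and it is not the case that every state of $\mathbb A_\alpha^\Phi$ has exactly one $\Phi$-invariant extension to a state of $\mathbb A_\alpha$. -/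

import Mathlib

open scoped ENNReal
open MeasureTheory

universe u

noncomputable section

namespace NCAnzai

open scoped CStarAlgebra

/-! ### The unit circle and its normalised Haar measure -/

/-- The Borel `σ`-algebra of the unit circle. -/
instance circleMeasurableSpace : MeasurableSpace Circle := borel Circle

instance circleBorelSpace : BorelSpace Circle := ⟨rfl⟩

/-- The normalised Haar (Lebesgue) measure of the unit circle. -/
def circleHaar : Measure Circle := Measure.haarMeasure ⊤

/-- A function on the circle, extended by zero to the plane, so that it can be fed to the
continuous functional calculus of a unitary element. -/
def circleExt (f : C(Circle, Circle)) (z : ℂ) : ℂ :=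
  open Classical in
  if h : z ∈ Submonoid.unitSphere ℂ then ((f ⟨z, h⟩ : Circle) : ℂ) else 0

/-- `f(w)` for a unitary `w` of a unital C*-algebra and a continuous `f : 𝕋 → 𝕋`. -/
def circleFun {B : Type*} [CStarAlgebra B] (f : C(Circle, Circle)) (w : B) : B :=
  cfc (circleExt f) w

lemma circleExt_coe (f : C(Circle, Circle)) (z : Circle) : circleExt f (z : ℂ) = f z := by
  have h : (z : ℂ) ∈ Submonoid.unitSphere ℂ := z.2
  simp only [circleExt, dif_pos h]
  rfl

lemma continuousOn_circleExt (f : C(Circle, Circle)) :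
    ContinuousOn (circleExt f) (Metric.sphere (0 : ℂ) 1) := by
  rw [continuousOn_iff_continuous_domRestrict]
  have : Set.domRestrict (Metric.sphere (0 : ℂ) 1) (circleExt f) =
      fun z => ((f (⟨z.1, z.2⟩ : Circle) : Circle) : ℂ) := by
    funext z
    exact circleExt_coe f ⟨z.1, z.2⟩
  rw [this]
  exact continuous_subtype_val.comp (f.continuous.comp continuous_id)

lemma spectrum_subset_circle {B : Type*} [CStarAlgebra B] {w : B} (hw : w ∈ unitary B) :
    spectrum ℂ w ⊆ Metric.sphere (0 : ℂ) 1 :=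
  spectrum.subset_circle_of_unitary hw

lemma continuousOn_circleExt_spectrum {B : Type*} [CStarAlgebra B] {w : B} (hw : w ∈ unitary B)
    (f : C(Circle, Circle)) : ContinuousOn (circleExt f) (spectrum ℂ w) :=
  (continuousOn_circleExt f).mono (spectrum_subset_circle hw)

lemma isStarNormal_of_unitary {B : Type*} [CStarAlgebra B] {w : B} (hw : w ∈ unitary B) :
    IsStarNormal w :=
  ⟨by rw [Commute, SemiconjBy, (Unitary.mem_iff.1 hw).1, (Unitary.mem_iff.1 hw).2]⟩

lemma circleFun_mem_unitary {B : Type*} [CStarAlgebra B] {w : B} (hw : w ∈ unitary B)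
    (f : C(Circle, Circle)) : circleFun f w ∈ unitary B := by
  have hn := isStarNormal_of_unitary hw
  refine (cfc_unitary_iff (circleExt f) w hn (continuousOn_circleExt_spectrum hw f)).2 ?_
  intro x hx
  obtain ⟨z, rfl⟩ : ∃ z : Circle, (z : ℂ) = x := ⟨⟨x, spectrum_subset_circle hw hx⟩, rfl⟩
  rw [circleExt_coe]
  have := Circle.normSq_coe (f z)
  simp [← Complex.normSq_eq_conj_mul_self, this]

lemma circleFun_commute {B : Type*} [CStarAlgebra B] (w : B) (f : C(Circle, Circle)) :
    Commute w (circleFun f w) := by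
  have := cfc_commute_cfc id (circleExt f) w (R := ℂ)
  by_cases hn : IsStarNormal w
  · rwa [cfc_id ℂ w] at this
  · have : circleFun f w = 0 := cfc_apply_of_not_predicate w hn
    rw [this]
    exact Commute.zero_right w

lemma smul_mem_unitary {B : Type*} [CStarAlgebra B] {w : B} (hw : w ∈ unitary B) (c : Circle) :
    (c : ℂ) • w ∈ unitary B := by
  have h : (starRingEnd ℂ) (c : ℂ) * (c : ℂ) = 1 := by
    rw [← Complex.normSq_eq_conj_mul_self, Circle.normSq_coe]; simp
  rw [Unitary.mem_iff]
  simp only [star_smul, smul_mul_smul_comm, (Unitary.mem_iff.1 hw).1, (Unitary.mem_iff.1 hw).2,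
    RCLike.star_def]
  constructor
  · rw [h, one_smul]
  · rw [mul_comm, h, one_smul]

/-! ### The noncommutative 2-torus

`NCTorus α` is the universal unital C*-algebra generated by two unitaries `U`, `V` with
`U V = e^{2 π i α} V U`: the closed *-subalgebra generated by the universal pair inside the
`ℓ^∞`-product of all (nonzero, unital) C*-algebras with a distinguished pair of unitaries that
satisfies the relation. Equivalently, the norm of a noncommutative polynomial in `U`, `V` is the
supremum of its norms over all such pairs. -/

/-- A representation of the commutation relation of parameter `α`: a pair of unitaries
`u`, `v` with `u v = e^{2 π i α} v u` in a nonzero unital C*-algebra. -/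
structure Rep (α : ℝ) : Type (u + 1) where
  /-- the C*-algebra that contains the pair -/
  carrier : Type u
  [cstar : CStarAlgebra carrier]
  [nontriv : Nontrivial carrier]
  /-- the first unitary -/
  u : carrier
  /-- the second unitary -/
  v : carrier
  u_mem : u ∈ unitary carrier
  v_mem : v ∈ unitary carrier
  rel : u * v = (Circle.exp (2 * Real.pi * α) : ℂ) • (v * u)

attribute [instance] Rep.cstar Rep.nontriv

/-- The `ℓ^∞`-product of all representations of the relation. -/
abbrev RepProd (α : ℝ) : Type (u + 1) := lp (fun i : Rep.{u} α => i.carrier) ∞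

instance repProdCStarAlgebra (α : ℝ) : CStarAlgebra (RepProd.{u} α) where

lemma memℓp_unitary {α : ℝ} (x : ∀ i : Rep.{u} α, i.carrier) (hx : ∀ i, x i ∈ unitary i.carrier) :
    Memℓp x ∞ :=
  memℓp_infty ⟨1, by
    rintro _ ⟨i, rfl⟩
    exact (CStarRing.norm_of_mem_unitary (hx i)).le⟩

/-- The universal pair, first component. -/
def prodU (α : ℝ) : RepProd.{u} α := ⟨fun i => i.u, memℓp_unitary _ fun i => i.u_mem⟩

/-- The universal pair, second component. -/
def prodV (α : ℝ) : RepProd.{u} α := ⟨fun i => i.v, memℓp_unitary _ fun i => i.v_mem⟩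

/-- The closed *-subalgebra generated by the universal pair. -/
def ncTorus (α : ℝ) : StarSubalgebra ℂ (RepProd.{u} α) :=
  (StarAlgebra.adjoin ℂ {prodU α, prodV α}).topologicalClosure

/-- The noncommutative 2-torus `𝔸_α`. -/
abbrev NCTorus (α : ℝ) : Type (u + 1) := ncTorus.{u} α

instance ncTorus_isClosed (α : ℝ) : IsClosed (ncTorus.{u} α : Set (RepProd.{u} α)) :=
  StarSubalgebra.isClosed_topologicalClosure _

instance ncTorusCStarAlgebra (α : ℝ) : CStarAlgebra (NCTorus.{u} α) :=
  StarSubalgebra.cstarAlgebra (ncTorus.{u} α)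

lemma prodU_mem (α : ℝ) : prodU α ∈ ncTorus.{u} α :=
  StarSubalgebra.le_topologicalClosure _ (StarAlgebra.subset_adjoin ℂ _ (by simp))

lemma prodV_mem (α : ℝ) : prodV α ∈ ncTorus.{u} α :=
  StarSubalgebra.le_topologicalClosure _ (StarAlgebra.subset_adjoin ℂ _ (by simp))

/-- The canonical generator `U`. -/
def genU (α : ℝ) : NCTorus.{u} α := ⟨prodU α, prodU_mem α⟩

/-- The canonical generator `V`. -/
def genV (α : ℝ) : NCTorus.{u} α := ⟨prodV α, prodV_mem α⟩

/-- The coordinate projection of the product. -/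
def prodEval {α : ℝ} (i : Rep.{u} α) : RepProd.{u} α →⋆ₐ[ℂ] i.carrier where
  toFun x := x i
  map_one' := rfl
  map_mul' _ _ := rfl
  map_zero' := rfl
  map_add' _ _ := rfl
  commutes' _ := rfl
  map_star' _ := rfl

/-- The representation of `𝔸_α` given by a pair of unitaries that satisfies the relation. -/
def eval {α : ℝ} (i : Rep.{u} α) : NCTorus.{u} α →⋆ₐ[ℂ] i.carrier :=
  (prodEval i).comp (ncTorus.{u} α).subtype

lemma genU_mem_unitary (α : ℝ) : genU.{u} α ∈ unitary (NCTorus.{u} α) := by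
  constructor <;> refine Subtype.ext (lp.ext (funext fun i => ?_))
  · exact (Unitary.mem_iff.1 i.u_mem).1
  · exact (Unitary.mem_iff.1 i.u_mem).2

lemma genV_mem_unitary (α : ℝ) : genV.{u} α ∈ unitary (NCTorus.{u} α) := by
  constructor <;> refine Subtype.ext (lp.ext (funext fun i => ?_))
  · exact (Unitary.mem_iff.1 i.v_mem).1
  · exact (Unitary.mem_iff.1 i.v_mem).2

lemma genU_mul_genV (α : ℝ) :
    genU.{u} α * genV α = (Circle.exp (2 * Real.pi * α) : ℂ) • (genV.{u} α * genU α) :=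
  Subtype.ext (lp.ext (funext fun i => i.rel))

/-- *-homomorphisms on `𝔸_α` are determined by their values on `U` and `V`. -/
lemma hom_ext {α : ℝ} {B : Type*} [CStarAlgebra B] {φ ψ : NCTorus.{u} α →⋆ₐ[ℂ] B}
    (hU : φ (genU α) = ψ (genU α)) (hV : φ (genV α) = ψ (genV α)) : φ = ψ := by
  have hφ : Continuous φ := map_continuous φ
  have hψ : Continuous ψ := map_continuous ψ
  refine StarAlgHom.ext_topologicalClosure (S := StarAlgebra.adjoin ℂ {prodU α, prodV α}) hφ hψ ?_
  refine StarAlgHom.ext_adjoin ?_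
  rintro ⟨x, hx⟩ hx'
  rcases hx' with rfl | rfl
  · exact hU
  · exact hV

/-- The universal property of `𝔸_α`. -/
theorem existsUnique_hom {α : ℝ} {B : Type u} [CStarAlgebra B] [Nontrivial B] (x y : B)
    (hx : x ∈ unitary B) (hy : y ∈ unitary B)
    (h : x * y = (Circle.exp (2 * Real.pi * α) : ℂ) • (y * x)) :
    ∃! φ : NCTorus.{u} α →⋆ₐ[ℂ] B, φ (genU α) = x ∧ φ (genV α) = y :=
  ⟨eval ⟨B, x, y, hx, hy, h⟩, ⟨rfl, rfl⟩, fun _ hψ => hom_ext hψ.1 hψ.2⟩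

/-! ### The Anzai skew-product -/

/-- The pair `(e^{iθ} u, f(u) v)`, which satisfies the same relation as `(u, v)`. -/
def Rep.skew {α : ℝ} (θ : ℝ) (f : C(Circle, Circle)) (i : Rep.{u} α) : Rep.{u} α where
  carrier := i.carrier
  u := (Circle.exp θ : ℂ) • i.u
  v := circleFun f i.u * i.v
  u_mem := smul_mem_unitary i.u_mem _
  v_mem := mul_mem (circleFun_mem_unitary i.u_mem f) i.v_mem
  rel := by
    have hc := circleFun_commute i.u f
    rw [smul_mul_assoc, mul_smul_comm, smul_comm, ← mul_assoc, hc.eq, mul_assoc, i.rel,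
      mul_smul_comm, ← mul_assoc]

/-- Precomposition with `Rep.skew` on the product. -/
def prodSkew (α θ : ℝ) (f : C(Circle, Circle)) : RepProd.{u} α →⋆ₐ[ℂ] RepProd.{u} α where
  toFun x := ⟨fun i => x (i.skew θ f), memℓp_infty ⟨‖x‖, by
    rintro _ ⟨i, rfl⟩
    exact lp.norm_apply_le_norm ENNReal.top_ne_zero x (i.skew θ f)⟩⟩
  map_one' := rfl
  map_mul' _ _ := rfl
  map_zero' := rfl
  map_add' _ _ := rfl
  commutes' _ := rfl
  map_star' _ := rfl

lemma eval_circleFun {α : ℝ} (f : C(Circle, Circle)) (i : Rep.{u} α) :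
    eval i (circleFun f (genU α)) = circleFun f i.u :=
  StarAlgHom.map_cfc (eval i) (circleExt f) (genU α)
    (continuousOn_circleExt_spectrum (genU_mem_unitary α) f)
    (map_continuous (eval i))
    (isStarNormal_of_unitary (genU_mem_unitary α)) (isStarNormal_of_unitary i.u_mem)

lemma prodSkew_U (α θ : ℝ) (f : C(Circle, Circle)) :
    prodSkew α θ f (prodU.{u} α) = (((Circle.exp θ : ℂ) • genU α : NCTorus.{u} α) : RepProd α) :=
  rfl

lemma prodSkew_V (α θ : ℝ) (f : C(Circle, Circle)) :
    prodSkew α θ f (prodV.{u} α) = ((circleFun f (genU α) * genV α : NCTorus.{u} α) : RepProd α) :=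
  lp.ext (funext fun i => congrArg (· * i.v) (eval_circleFun f i).symm)

lemma prodSkew_mem (α θ : ℝ) (f : C(Circle, Circle)) (x : NCTorus.{u} α) :
    prodSkew α θ f x ∈ ncTorus.{u} α := by
  have hc : Continuous (prodSkew.{u} α θ f) := map_continuous (prodSkew.{u} α θ f)
  have h : ncTorus.{u} α ≤ (ncTorus.{u} α).comap (prodSkew α θ f) := by
    refine StarSubalgebra.topologicalClosure_minimal ?_ ((ncTorus_isClosed α).preimage hc)
    refine StarAlgebra.adjoin_le ?_
    rintro _ (rfl | rfl)
    · change prodSkew α θ f (prodU α) ∈ ncTorus.{u} α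
      rw [prodSkew_U]
      exact Subtype.property _
    · change prodSkew α θ f (prodV α) ∈ ncTorus.{u} α
      rw [prodSkew_V]
      exact Subtype.property _
  exact h x.2

/-- The Anzai skew-product as an endomorphism of `𝔸_α`. -/
def anzaiHom (α θ : ℝ) (f : C(Circle, Circle)) : NCTorus.{u} α →⋆ₐ[ℂ] NCTorus.{u} α :=
  ((prodSkew α θ f).comp (ncTorus.{u} α).subtype).codRestrict (ncTorus.{u} α)
    (prodSkew_mem α θ f)

lemma anzaiHom_genU (α θ : ℝ) (f : C(Circle, Circle)) :
    anzaiHom α θ f (genU.{u} α) = (Circle.exp θ : ℂ) • genU α :=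
  Subtype.ext (prodSkew_U α θ f)

lemma anzaiHom_genV (α θ : ℝ) (f : C(Circle, Circle)) :
    anzaiHom α θ f (genV.{u} α) = circleFun f (genU α) * genV α :=
  Subtype.ext (prodSkew_V α θ f)

lemma circleFun_smul {B : Type*} [CStarAlgebra B] {w : B} (hw : w ∈ unitary B) (c : Circle)
    (f : C(Circle, Circle)) :
    circleFun f ((c : ℂ) • w) = circleFun (f.comp (ContinuousMap.mulLeft c)) w := by
  have hn := isStarNormal_of_unitary hw
  have hs := spectrum_subset_circle hw
  have hc : ContinuousOn (circleExt f) ((fun x => (c : ℂ) • x) '' spectrum ℂ w) := by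
    refine (continuousOn_circleExt f).mono ?_
    rintro _ ⟨x, hx, rfl⟩
    have := hs hx
    simp only [mem_sphere_zero_iff_norm] at this ⊢
    rw [norm_smul, this, Circle.norm_coe, one_mul]
  unfold circleFun
  rw [← cfc_comp_smul (c : ℂ) (circleExt f) w hc hn]
  refine cfc_congr fun x hx => ?_
  obtain ⟨z, rfl⟩ : ∃ z : Circle, (z : ℂ) = x := ⟨⟨x, hs hx⟩, rfl⟩
  change circleExt f ((c * z : Circle) : ℂ) = _
  rw [circleExt_coe, circleExt_coe]
  rfl

lemma circleFun_mul_eq_one {B : Type*} [CStarAlgebra B] {w : B} (hw : w ∈ unitary B)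
    {f g : C(Circle, Circle)} (h : ∀ z, f z * g z = 1) : circleFun f w * circleFun g w = 1 := by
  have hn := isStarNormal_of_unitary hw
  unfold circleFun
  rw [← cfc_mul _ _ w (continuousOn_circleExt_spectrum hw f)
    (continuousOn_circleExt_spectrum hw g), ← cfc_one ℂ w]
  refine cfc_congr fun x hx => ?_
  obtain ⟨z, rfl⟩ : ∃ z : Circle, (z : ℂ) = x := ⟨⟨x, spectrum_subset_circle hw hx⟩, rfl⟩
  rw [circleExt_coe, circleExt_coe, ← Circle.coe_mul, h]
  rfl

/-- The function that belongs to the inverse of the skew-product. -/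
def skewInv (θ : ℝ) (f : C(Circle, Circle)) : C(Circle, Circle) :=
  (f.comp (ContinuousMap.mulLeft (Circle.exp (-θ))))⁻¹

lemma skewInv_skewInv (θ : ℝ) (f : C(Circle, Circle)) : skewInv (-θ) (skewInv θ f) = f := by
  ext z
  simp [skewInv]

lemma anzaiHom_inv_comp (α θ : ℝ) (f : C(Circle, Circle)) :
    (anzaiHom.{u} α (-θ) (skewInv θ f)).comp (anzaiHom α θ f) = StarAlgHom.id ℂ _ := by
  set Ψ := anzaiHom.{u} α (-θ) (skewInv θ f) with hΨ
  have hU := genU_mem_unitary.{u} α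
  have hΨU : Ψ (genU α) = (Circle.exp (-θ) : ℂ) • genU α := anzaiHom_genU α (-θ) _
  have hΨf : Ψ (circleFun f (genU α)) = circleFun f ((Circle.exp (-θ) : ℂ) • genU α) := by
    have := StarAlgHom.map_cfc Ψ (circleExt f) (genU α) (continuousOn_circleExt_spectrum hU f)
      (map_continuous Ψ) (isStarNormal_of_unitary hU)
      (by rw [hΨU]; exact isStarNormal_of_unitary (smul_mem_unitary hU _))
    rwa [hΨU] at this
  refine hom_ext ?_ ?_
  · rw [StarAlgHom.comp_apply, anzaiHom_genU, map_smul, hΨU, smul_smul, ← Circle.coe_mul,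
      ← Circle.exp_add]
    simp
  · rw [StarAlgHom.comp_apply, anzaiHom_genV, map_mul, hΨf, hΨ, anzaiHom_genV, circleFun_smul hU,
      ← mul_assoc, circleFun_mul_eq_one hU, one_mul]
    · rfl
    · intro z
      simp [skewInv]

/-- The Anzai skew-product `Φ_{θ,f}`: the *-automorphism of `𝔸_α` with
`Φ(U) = e^{iθ} U` and `Φ(V) = f(U) V`. -/
def anzai (α θ : ℝ) (f : C(Circle, Circle)) : NCTorus.{u} α ≃⋆ₐ[ℂ] NCTorus.{u} α :=
  StarAlgEquiv.ofStarAlgHom (anzaiHom α θ f) (anzaiHom α (-θ) (skewInv θ f))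
    (anzaiHom_inv_comp α θ f)
    (by
      have := anzaiHom_inv_comp.{u} α (-θ) (skewInv θ f)
      rwa [skewInv_skewInv, neg_neg] at this)

lemma anzai_genU (α θ : ℝ) (f : C(Circle, Circle)) :
    anzai α θ f (genU.{u} α) = (Circle.exp θ : ℂ) • genU α :=
  anzaiHom_genU α θ f

lemma anzai_genV (α θ : ℝ) (f : C(Circle, Circle)) :
    anzai α θ f (genV.{u} α) = circleFun f (genU α) * genV α :=
  anzaiHom_genV α θ f

/-! ### The cohomological equation -/

/-- The functions `f_n`: `f_n(z) = ∏_{0 ≤ l < n} f(e^{-2πilα} z)` for `n ≥ 0` and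
`f_n(z) = ∏_{1 ≤ l ≤ |n|} conj f(e^{2πilα} z)` for `n < 0`. -/
def cocycle (α : ℝ) (f : C(Circle, Circle)) (n : ℤ) (z : Circle) : Circle :=
  if 0 ≤ n then ∏ l ∈ Finset.range n.natAbs, f (Circle.exp (-(2 * Real.pi * (l * α))) * z)
  else ∏ l ∈ Finset.Icc 1 n.natAbs, (f (Circle.exp (2 * Real.pi * (l * α)) * z))⁻¹

/-- `g` solves `(g ∘ R_{θ/2π}) f_n = g`, as an identity in `L²`. -/
def SolvesCohomological (α θ : ℝ) (f : C(Circle, Circle)) (n : ℤ) (g : Lp ℂ 2 circleHaar) : Prop :=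
  ∀ᵐ z ∂circleHaar, g (Circle.exp θ * z) * (cocycle α f n z : ℂ) = g z

/-! ### Cesàro means, states and unique ergodicity -/

/-- The Cesàro mean `(1/n) ∑_{k<n} Φ^k(a)`. -/
def cesaroMean {A : Type*} [AddCommMonoid A] [Module ℂ A] (Φ : A → A) (a : A) (n : ℕ) : A :=
  (n : ℂ)⁻¹ • ∑ k ∈ Finset.range n, Φ^[k] a

/-- States of a unital *-algebra: unital positive linear functionals (on a C*-algebra these are
automatically continuous). -/
structure IsState {A : Type*} [Ring A] [StarRing A] [Algebra ℂ A] (φ : A →ₗ[ℂ] ℂ) : Prop where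
  map_one : φ 1 = 1
  nonneg : ∀ a, 0 ≤ (φ (star a * a)).re ∧ (φ (star a * a)).im = 0

/-- The fixed-point subalgebra `A^Φ`. -/
def fixedSubalgebra {A : Type*} [CStarAlgebra A] (Φ : A ≃⋆ₐ[ℂ] A) : StarSubalgebra ℂ A :=
  StarAlgHom.equalizer (Φ : A →⋆ₐ[ℂ] A) (StarAlgHom.id ℂ A)

/-- Unique ergodicity with respect to the fixed-point subalgebra: every state of `A^Φ` has exactly
one `Φ`-invariant extension to a state of `A`. -/
def UniquelyErgodicRelFixed {A : Type*} [CStarAlgebra A] (Φ : A ≃⋆ₐ[ℂ] A) : Prop :=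
  ∀ ψ : fixedSubalgebra Φ →ₗ[ℂ] ℂ, IsState ψ →
    ∃! φ : A →ₗ[ℂ] ℂ, IsState φ ∧ (∀ a, φ (Φ a) = φ a) ∧ ∀ b : fixedSubalgebra Φ, φ b = ψ b

end NCAnzai
end

/-!
Every point `z` of the circle gives a representation of `𝔸_α` on `ℓ²(ℤ)`, with `U` diagonal and `V`
the bilateral shift, and the representations at `z` and `e^{iθ} z` are intertwined along `Φ` by a
diagonal unitary. By ergodicity of the rotation, a nonzero solution `g` of the cohomological
equation has constant modulus, so it is a multiple of a circle-valued solution `γ`. The equation for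
`γ` says that the field of unit vectors `ξ_z = 2^{-1/2} (e_0 + conj γ(z) e_{-n})` is covariant, and
integrating its vector states gives a `Φ`-invariant state of `𝔸_α`.

Replacing `γ` by `-γ` changes only the contribution of the matrix coefficients at `(0, -n)` and
`(-n, 0)`, and the state does change on some `F(U) V^n`. The two states nevertheless agree on fixed
points: the `(0, -n)` coefficient of a fixed point is a *continuous* solution of the cohomological
equation, hence by ergodicity a multiple of `γ`, hence zero. A weak limit of the Cesàro means of `a`
would be a fixed point at which each invariant state has the same value as at `a`, which is
impossible when the two states differ at `a`.
-/

noncomputable section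

namespace NCAnzai

open Filter Topology
open scoped CStarAlgebra ComplexConjugate

/-! ### Weak limits of Cesàro means -/

section WeakLimit

variable {E : Type*} [NormedAddCommGroup E] [NormedSpace ℂ E]

lemma tendsto_toWeakSpace {ι : Type*} {l : Filter ι} {x : ι → E} {b : E}
    (h : Tendsto x l (𝓝 b)) :
    Tendsto (fun i => toWeakSpace ℂ E (x i)) l (𝓝 (toWeakSpace ℂ E b)) :=
  ((toWeakSpaceCLM ℂ E).continuous.tendsto b).comp h

lemma tendsto_apply_of_tendsto_toWeakSpace {ι : Type*} {l : Filter ι} {x : ι → E} {b : E}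
    (h : Tendsto (fun i => toWeakSpace ℂ E (x i)) l (𝓝 (toWeakSpace ℂ E b))) (L : E →L[ℂ] ℂ) :
    Tendsto (fun i => L (x i)) l (𝓝 (L b)) :=
  ((WeakBilin.eval_continuous (topDualPairing ℂ E).flip L).tendsto _).comp h

lemma cesaroMean_eq_birkhoffAverage (Φ : E → E) (a : E) (N : ℕ) :
    cesaroMean Φ a N = birkhoffAverage ℂ Φ id N a := rfl

lemma map_cesaroMean (Φ : E →L[ℂ] E) (a : E) (N : ℕ) :
    Φ (cesaroMean Φ a N) = cesaroMean Φ (Φ a) N := by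
  simp only [cesaroMean, map_smul, map_sum, ← Function.iterate_succ_apply,
    Function.iterate_succ_apply']

lemma tendsto_map_cesaroMean_sub_cesaroMean {Φ : E →L[ℂ] E} {a : E}
    (ha : Bornology.IsBounded (Set.range fun k : ℕ => Φ^[k] a)) :
    Tendsto (fun N => Φ (cesaroMean Φ a N) - cesaroMean Φ a N) atTop (𝓝 0) := by
  simp only [map_cesaroMean]
  exact tendsto_birkhoffAverage_apply_sub_birkhoffAverage (g := id) ℂ ha

lemma map_cesaroMean_of_invariant {Φ : E → E} {L : E →L[ℂ] ℂ} (hL : ∀ x, L (Φ x) = L x) (a : E)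
    {N : ℕ} (hN : N ≠ 0) : L (cesaroMean Φ a N) = L a := by
  rw [cesaroMean_eq_birkhoffAverage, map_birkhoffAverage ℂ ℂ L]
  exact congrFun (birkhoffAverage_of_comp_eq (R := ℂ) (funext hL) (Nat.cast_ne_zero.2 hN)) a

lemma map_eq_of_tendsto_toWeakSpace_cesaroMean {Φ : E →L[ℂ] E} {a b : E}
    (ha : Bornology.IsBounded (Set.range fun k : ℕ => Φ^[k] a))
    (h : Tendsto (fun N => toWeakSpace ℂ E (cesaroMean Φ a N)) atTop (𝓝 (toWeakSpace ℂ E b))) :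
    Φ b = b := by
  refine (SeparatingDual.eq_iff_forall_dual_eq (R := ℂ)).2 fun L => sub_eq_zero.1 ?_
  have hlim : Tendsto (fun N => L (Φ (cesaroMean Φ a N)) - L (cesaroMean Φ a N)) atTop
      (𝓝 (L (Φ b) - L b)) :=
    (tendsto_apply_of_tendsto_toWeakSpace h (L ∘L Φ)).sub
      (tendsto_apply_of_tendsto_toWeakSpace h L)
  have hzero := (L.continuous.tendsto 0).comp (tendsto_map_cesaroMean_sub_cesaroMean ha)
  simp only [Function.comp_def, map_sub, map_zero] at hzero
  exact tendsto_nhds_unique hlim hzero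

lemma apply_eq_of_tendsto_toWeakSpace_cesaroMean {Φ : E → E} {L : E →L[ℂ] ℂ}
    (hL : ∀ x, L (Φ x) = L x) {a b : E}
    (h : Tendsto (fun N => toWeakSpace ℂ E (cesaroMean Φ a N)) atTop (𝓝 (toWeakSpace ℂ E b))) :
    L b = L a :=
  tendsto_nhds_unique (tendsto_apply_of_tendsto_toWeakSpace h L) <|
    tendsto_const_nhds.congr' <| (eventually_ne_atTop 0).mono fun _ hN =>
      (map_cesaroMean_of_invariant hL a hN).symm

theorem not_tendsto_toWeakSpace_cesaroMean {Φ : E →L[ℂ] E} {L₁ L₂ : E →L[ℂ] ℂ}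
    (h₁ : ∀ x, L₁ (Φ x) = L₁ x) (h₂ : ∀ x, L₂ (Φ x) = L₂ x)
    (hfix : ∀ b, Φ b = b → L₁ b = L₂ b) {a : E} (hne : L₁ a ≠ L₂ a)
    (ha : Bornology.IsBounded (Set.range fun k : ℕ => Φ^[k] a)) :
    ¬ ∃ b, Tendsto (fun N => toWeakSpace ℂ E (cesaroMean Φ a N)) atTop
      (𝓝 (toWeakSpace ℂ E b)) := by
  rintro ⟨b, hb⟩
  refine hne ?_
  rw [← apply_eq_of_tendsto_toWeakSpace_cesaroMean h₁ hb,
    ← apply_eq_of_tendsto_toWeakSpace_cesaroMean h₂ hb]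
  exact hfix b (map_eq_of_tendsto_toWeakSpace_cesaroMean ha hb)

end WeakLimit

/-! ### Invariant states -/

section States

variable {A : Type*} [CStarAlgebra A]

open scoped ComplexOrder in
lemma IsState.continuous {φ : A →ₗ[ℂ] ℂ} (hφ : IsState φ) : Continuous φ := by
  let _ := CStarAlgebra.spectralOrder A
  have _ := CStarAlgebra.spectralOrderedRing A
  have hpos : ∀ a, 0 ≤ a → 0 ≤ φ a := by
    intro a ha
    obtain ⟨b, rfl⟩ := CStarAlgebra.nonneg_iff_eq_star_mul_self.1 ha
    exact Complex.nonneg_iff.2 ⟨(hφ.nonneg b).1, (hφ.nonneg b).2.symm⟩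
  obtain ⟨C, hC⟩ := PositiveLinearMap.exists_norm_apply_le (PositiveLinearMap.mk₀ φ hpos)
  exact AddMonoidHomClass.continuous_of_bound φ C hC

variable {Φ : A ≃⋆ₐ[ℂ] A} {φ₁ φ₂ : A →ₗ[ℂ] ℂ}

lemma isBounded_range_iterate (Φ : A ≃⋆ₐ[ℂ] A) (a : A) :
    Bornology.IsBounded (Set.range fun k : ℕ => Φ^[k] a) := by
  refine (Metric.isBounded_closedBall (x := (0 : A)) (r := ‖a‖)).subset ?_
  rintro _ ⟨k, rfl⟩
  induction k with
  | zero => simp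
  | succ k ih => simpa only [Function.iterate_succ_apply', mem_closedBall_zero_iff,
      StarAlgEquiv.norm_map] using ih

lemma not_tendsto_toWeakSpace_cesaroMean_of_isState (h₁ : IsState φ₁) (h₂ : IsState φ₂)
    (hΦ₁ : ∀ x, φ₁ (Φ x) = φ₁ x) (hΦ₂ : ∀ x, φ₂ (Φ x) = φ₂ x)
    (hfix : ∀ b, Φ b = b → φ₁ b = φ₂ b) {a : A} (hne : φ₁ a ≠ φ₂ a) :
    ¬ ∃ b, Tendsto (fun N => toWeakSpace ℂ A (cesaroMean Φ a N)) atTop (𝓝 (toWeakSpace ℂ A b)) :=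
  not_tendsto_toWeakSpace_cesaroMean
    (Φ := ⟨(Φ : A →ₗ[ℂ] A), (StarAlgEquiv.isometry Φ).continuous⟩)
    (L₁ := ⟨φ₁, h₁.continuous⟩) (L₂ := ⟨φ₂, h₂.continuous⟩) hΦ₁ hΦ₂ hfix hne
    (isBounded_range_iterate Φ a)

lemma IsState.comp_subtype {φ : A →ₗ[ℂ] ℂ} (hφ : IsState φ) (S : StarSubalgebra ℂ A) :
    IsState (φ ∘ₗ S.subtype.toLinearMap) :=
  ⟨hφ.map_one, fun b => hφ.nonneg b⟩

theorem not_uniquelyErgodicRelFixed (h₁ : IsState φ₁) (h₂ : IsState φ₂)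
    (hΦ₁ : ∀ x, φ₁ (Φ x) = φ₁ x) (hΦ₂ : ∀ x, φ₂ (Φ x) = φ₂ x)
    (hfix : ∀ b, Φ b = b → φ₁ b = φ₂ b) (hne : φ₁ ≠ φ₂) : ¬ UniquelyErgodicRelFixed Φ := by
  intro h
  refine hne ((h _ (h₁.comp_subtype (fixedSubalgebra Φ))).unique ⟨h₁, hΦ₁, fun _ => rfl⟩
    ⟨h₂, hΦ₂, fun b => (hfix b b.2).symm⟩)

end States

/-! ### Functional calculus on eigenvectors -/

section Eigenvector

variable {H : Type*} [NormedAddCommGroup H] [InnerProductSpace ℂ H] [CompleteSpace H]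
  {T : H →L[ℂ] H} {v : H} {c : ℂ}

lemma mem_spectrum_of_apply_eq_smul (hv : v ≠ 0) (h : T v = c • v) : c ∈ spectrum ℂ T := by
  rw [ContinuousLinearMap.spectrum_eq]
  exact (Module.End.hasEigenvalue_of_hasEigenvector
    ⟨Module.End.mem_eigenspace_iff.2 h, hv⟩).mem_spectrum

lemma star_apply_of_apply_eq_smul (hT : IsStarNormal T) (h : T v = c • v) :
    star T v = conj c • v := by
  have hn : IsStarNormal (T - c • 1) := ⟨by
    rw [star_sub, star_smul, star_one]
    exact ((hT.star_comm_self.sub_left ((Commute.one_left T).smul_left _)).sub_right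
      ((Commute.one_right _).smul_right _))⟩
  have hker : star (T - c • 1) v = 0 :=
    (ContinuousLinearMap.IsStarNormal.adjoint_apply_eq_zero_iff hn v).2 (by simp [h])
  simpa [sub_eq_zero] using hker

lemma cfcHom_apply_of_apply_eq_smul (hT : IsStarNormal T) (hc : c ∈ spectrum ℂ T)
    (h : T v = c • v) (k : C(spectrum ℂ T, ℂ)) : cfcHom hT k v = k ⟨c, hc⟩ • v := by
  induction k using ContinuousMap.induction_on_of_compact with
  | const r =>
    have hconst : ContinuousMap.const (spectrum ℂ T) r = algebraMap ℂ C(spectrum ℂ T, ℂ) r := rfl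
    rw [hconst, AlgHomClass.commutes, ContinuousLinearMap.algebraMap_apply]
    rfl
  | id => rwa [cfcHom_id hT]
  | star_id =>
    rw [map_star, cfcHom_id hT]
    exact star_apply_of_apply_eq_smul hT h
  | add f g hf hg => rw [map_add, add_apply, hf, hg, ← add_smul]; rfl
  | mul f g hf hg => rw [map_mul, mul_apply_eq_comp, hg, map_smul, hf, smul_smul, mul_comm]; rfl
  | frequently f hf =>
    exact hf.mem_of_closed <| isClosed_eq
      ((ContinuousLinearMap.apply ℂ H v).continuous.comp (cfcHom_continuous hT))
      ((ContinuousEvalConst.continuous_eval_const _).smul continuous_const)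

lemma cfc_apply_of_apply_eq_smul (hT : IsStarNormal T) (h : T v = c • v) {F : ℂ → ℂ}
    (hF : ContinuousOn F (spectrum ℂ T)) : cfc F T v = F c • v := by
  obtain rfl | hv := eq_or_ne v 0
  · simp only [map_zero, smul_zero]
  · rw [cfc_apply F T hT hF]
    exact cfcHom_apply_of_apply_eq_smul hT (mem_spectrum_of_apply_eq_smul hv h) h _

end Eigenvector

/-! ### Weighted permutations of a Hilbert basis -/

section WeightedPerm

variable {ι H : Type*} [NormedAddCommGroup H] [InnerProductSpace ℂ H]

lemma continuousLinearMap_ext_hilbertBasis (b : HilbertBasis ι ℂ H) {S T : H →L[ℂ] H}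
    (h : ∀ i, S (b i) = T (b i)) : S = T :=
  ContinuousLinearMap.ext_on (Submodule.dense_iff_topologicalClosure_eq_top.2 b.dense_span)
    (Set.forall_mem_range.2 h)

lemma orthonormal_weightedPerm (b : HilbertBasis ι ℂ H) (σ : Equiv.Perm ι) (c : ι → Circle) :
    Orthonormal ℂ fun i => (c i : ℂ) • b (σ i) := by
  have hb := b.orthonormal.comp σ σ.injective
  refine ⟨fun i => ?_, fun i j hij => ?_⟩
  · rw [norm_smul, Circle.norm_coe, one_mul]
    exact hb.1 i
  · have hσ : inner ℂ (b (σ i)) (b (σ j)) = 0 := hb.2 hij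
    simp only [inner_smul_left, inner_smul_right, hσ, mul_zero]

lemma top_le_closure_span_weightedPerm (b : HilbertBasis ι ℂ H) (σ : Equiv.Perm ι)
    (c : ι → Circle) :
    ⊤ ≤ (Submodule.span ℂ (Set.range fun i => (c i : ℂ) • b (σ i))).topologicalClosure := by
  rw [← b.dense_span]
  refine Submodule.topologicalClosure_mono (Submodule.span_le.2 ?_)
  rintro _ ⟨i, rfl⟩
  have hi := Submodule.smul_mem _ ((c (σ.symm i) : ℂ)⁻¹) <| Submodule.subset_span (R := ℂ) <|
    Set.mem_range_self (f := fun i => (c i : ℂ) • b (σ i)) (σ.symm i)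
  rwa [inv_smul_smul₀ (Circle.coe_ne_zero _), Equiv.apply_symm_apply] at hi

variable [CompleteSpace H]

/-- The Hilbert basis `c i • b (σ i)` obtained from `b` by a permutation of the index set and
unimodular weights. -/
def weightedPermBasis (b : HilbertBasis ι ℂ H) (σ : Equiv.Perm ι) (c : ι → Circle) :
    HilbertBasis ι ℂ H :=
  HilbertBasis.mk (orthonormal_weightedPerm b σ c) (top_le_closure_span_weightedPerm b σ c)

/-- The unitary operator sending the basis vector `b i` to `c i • b (σ i)`. -/
def weightedPerm (b : HilbertBasis ι ℂ H) (σ : Equiv.Perm ι) (c : ι → Circle) :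
    unitary (H →L[ℂ] H) :=
  Unitary.linearIsometryEquiv.symm <|
    b.repr.trans (weightedPermBasis b σ c).repr.symm

lemma weightedPerm_apply (b : HilbertBasis ι ℂ H) (σ : Equiv.Perm ι) (c : ι → Circle) (i : ι) :
    (weightedPerm b σ c : H →L[ℂ] H) (b i) = (c i : ℂ) • b (σ i) := by
  classical
  change (weightedPermBasis b σ c).repr.symm (b.repr (b i)) = _
  rw [b.repr_self, HilbertBasis.repr_symm_single, weightedPermBasis, HilbertBasis.coe_mk]

lemma map_zpow_apply_of_apply_eq_succ {A : Type*} [CStarAlgebra A] (π : A →⋆ₐ[ℂ] (H →L[ℂ] H))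
    {w : unitary A} {e : ℤ → H} (hw : ∀ k, π w (e k) = e (k + 1)) (n k : ℤ) :
    π (w ^ n : unitary A) (e k) = e (k + n) := by
  induction n generalizing k with
  | zero => simp
  | succ m ih =>
    rw [zpow_add_one, Submonoid.coe_mul, map_mul, mul_apply_eq_comp, hw, ih, add_assoc, add_comm 1]
  | pred m ih =>
    obtain ⟨j, rfl⟩ : ∃ j, k = j + 1 := ⟨k - 1, by ring⟩
    rw [← hw, ← mul_apply_eq_comp, ← map_mul, ← Submonoid.coe_mul, ← zpow_add_one, sub_add_cancel,
      ih]
    congr 1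
    ring

end WeightedPerm

/-! ### The representations attached to the points of the circle -/

/-- The orbit `e^{2πikα}`, `k ∈ ℤ`, of the rotation that defines `𝔸_α`. -/
def rotOrbit (α : ℝ) (k : ℤ) : Circle := Circle.exp (2 * Real.pi * (k * α))

lemma rotOrbit_zero (α : ℝ) : rotOrbit α 0 = 1 := by simp [rotOrbit]

lemma rotOrbit_add_one (α : ℝ) (k : ℤ) :
    rotOrbit α (k + 1) = Circle.exp (2 * Real.pi * α) * rotOrbit α k := by
  rw [rotOrbit, rotOrbit, ← Circle.exp_add]
  congr 1
  push_cast
  ring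

lemma cocycle_natCast (α : ℝ) (f : C(Circle, Circle)) (m : ℕ) (z : Circle) :
    cocycle α f m z = ∏ l ∈ Finset.range m, f (rotOrbit α (-l) * z) := by
  rw [cocycle, if_pos m.cast_nonneg, Int.natAbs_natCast]
  simp only [rotOrbit, Int.cast_neg, Int.cast_natCast, neg_mul, mul_neg]

lemma cocycle_neg_natCast (α : ℝ) (f : C(Circle, Circle)) (m : ℕ) (z : Circle) :
    cocycle α f (-m) z = ∏ l ∈ Finset.Icc 1 m, (f (rotOrbit α l * z))⁻¹ := by
  rcases m.eq_zero_or_pos with rfl | hm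
  · simp [cocycle]
  · rw [cocycle, if_neg (by omega), Int.natAbs_neg, Int.natAbs_natCast]
    rfl

lemma cocycle_zero (α : ℝ) (f : C(Circle, Circle)) (z : Circle) : cocycle α f 0 z = 1 :=
  cocycle_natCast α f 0 z

lemma cocycle_add_one (α : ℝ) (f : C(Circle, Circle)) (n : ℤ) (z : Circle) :
    cocycle α f (n + 1) z = f (rotOrbit α (-n) * z) * cocycle α f n z := by
  obtain ⟨m, rfl | rfl⟩ := n.eq_nat_or_neg
  · rw [← Nat.cast_succ, cocycle_natCast, cocycle_natCast, Finset.prod_range_succ, mul_comm]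
  · rcases m with _ | m
    · simpa [cocycle_zero] using cocycle_natCast α f 1 z
    · rw [Nat.cast_succ, neg_add, neg_add_cancel_right, ← neg_add, ← Nat.cast_succ,
        cocycle_neg_natCast, cocycle_neg_natCast, Finset.prod_Icc_succ_top (by omega), neg_neg,
        mul_left_comm, mul_inv_cancel, mul_one]

/-- The eigenvalues `f_{-k}(z)⁻¹` of the diagonal unitary that intertwines the representations
attached to `z` and `e^{iθ} z` along the skew-product. -/
def intertwinerWeight (α : ℝ) (f : C(Circle, Circle)) (z : Circle) (k : ℤ) : Circle :=
  (cocycle α f (-k) z)⁻¹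

lemma intertwinerWeight_zero (α : ℝ) (f : C(Circle, Circle)) (z : Circle) :
    intertwinerWeight α f z 0 = 1 := by
  rw [intertwinerWeight, neg_zero, cocycle_zero, inv_one]

lemma intertwinerWeight_add_one (α : ℝ) (f : C(Circle, Circle)) (z : Circle) (k : ℤ) :
    intertwinerWeight α f z (k + 1) =
      f (rotOrbit α (k + 1) * z) * intertwinerWeight α f z k := by
  have h := cocycle_add_one α f (-(k + 1)) z
  rw [neg_neg, neg_add, neg_add_cancel_right, ← neg_add] at h
  rw [intertwinerWeight, intertwinerWeight, h, mul_inv, mul_inv_cancel_left]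

lemma apply_eq_conj_of_gen {α : ℝ} {B : Type*} [CStarAlgebra B] {φ ψ : NCTorus.{u} α →⋆ₐ[ℂ] B}
    {w : unitary B} (hU : φ (genU α) * w = w * ψ (genU α))
    (hV : φ (genV α) * w = w * ψ (genV α)) (x : NCTorus.{u} α) :
    φ x = w * ψ x * star (w : B) := by
  have hconj {s t : B} (h : s * w = w * t) : s = Unitary.conjStarAlgAut ℂ B w t := by
    rw [Unitary.conjStarAlgAut_apply, ← h, mul_assoc, Unitary.mul_star_self_of_mem w.2, mul_one]
  have hφψ : φ = (Unitary.conjStarAlgAut ℂ B w : B →⋆ₐ[ℂ] B).comp ψ :=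
    hom_ext (hconj hU) (hconj hV)
  exact congr($hφψ x)

section PointHom

variable {H : Type u} [NormedAddCommGroup H] [InnerProductSpace ℂ H] [CompleteSpace H]
  (b : HilbertBasis ℤ ℂ H)

/-- The representation on a Hilbert space with basis `b` such that `U b_k = e^{2πikα} z b_k` and
`V b_k = b_{k+1}`. -/
def pointRep (α : ℝ) (z : Circle) : Rep.{u} α where
  carrier := H →L[ℂ] H
  nontriv := ⟨1, 0, fun h => b.orthonormal.ne_zero 0 congr($h (b 0))⟩
  u := weightedPerm b 1 fun k => rotOrbit α k * z
  v := weightedPerm b (Equiv.addRight 1) 1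
  u_mem := SetLike.coe_mem _
  v_mem := SetLike.coe_mem _
  rel := by
    refine continuousLinearMap_ext_hilbertBasis b fun k => ?_
    simp only [mul_apply_eq_comp, smul_apply, weightedPerm_apply, map_smul, Pi.one_apply,
      Circle.coe_one, one_smul, Equiv.Perm.one_apply, Equiv.coe_addRight, smul_smul,
      rotOrbit_add_one, Circle.coe_mul, mul_assoc]

/-- The representation of `𝔸_α` attached to the point `z`, through its universal property. -/
def pointHom (α : ℝ) (z : Circle) : NCTorus.{u} α →⋆ₐ[ℂ] (H →L[ℂ] H) := eval (pointRep b α z)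

lemma pointHom_genU_apply (α : ℝ) (z : Circle) (k : ℤ) :
    pointHom b α z (genU α) (b k) = ((rotOrbit α k * z : Circle) : ℂ) • b k :=
  weightedPerm_apply b 1 _ k

lemma pointHom_genV_apply (α : ℝ) (z : Circle) (k : ℤ) :
    pointHom b α z (genV α) (b k) = b (k + 1) :=
  (weightedPerm_apply b (Equiv.addRight 1) 1 k).trans (one_smul ℂ _)

lemma pointHom_cfc_genU_apply (α : ℝ) (z : Circle) {F : ℂ → ℂ}
    (hF : ContinuousOn F (Metric.sphere 0 1)) (k : ℤ) :
    pointHom b α z (cfc F (genU α)) (b k) = F (rotOrbit α k * z : Circle) • b k := by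
  have hU := genU_mem_unitary.{u} α
  have hn : IsStarNormal (pointHom b α z (genU α)) :=
    isStarNormal_of_unitary (pointRep b α z).u_mem
  rw [StarAlgHom.map_cfc (pointHom b α z) F (genU α) (hF.mono (spectrum_subset_circle hU))
    (map_continuous _) (isStarNormal_of_unitary hU) hn]
  exact cfc_apply_of_apply_eq_smul hn (pointHom_genU_apply b α z k)
    (hF.mono (spectrum_subset_circle (pointRep b α z).u_mem))

lemma pointHom_genV_zpow_apply (α : ℝ) (z : Circle) (n k : ℤ) :
    pointHom b α z ((⟨genV α, genV_mem_unitary α⟩ ^ n : unitary (NCTorus.{u} α)) : NCTorus.{u} α)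
      (b k) = b (k + n) :=
  map_zpow_apply_of_apply_eq_succ _ (pointHom_genV_apply b α z) n k

/-- The diagonal unitary that intertwines the representations attached to `z` and `e^{iθ} z` along
the skew-product. -/
def intertwiner (α : ℝ) (f : C(Circle, Circle)) (z : Circle) : unitary (H →L[ℂ] H) :=
  weightedPerm b 1 (intertwinerWeight α f z)

lemma intertwiner_apply (α : ℝ) (f : C(Circle, Circle)) (z : Circle) (k : ℤ) :
    (intertwiner b α f z : H →L[ℂ] H) (b k) = (intertwinerWeight α f z k : ℂ) • b k :=
  weightedPerm_apply b 1 _ k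

lemma star_intertwiner_apply (α : ℝ) (f : C(Circle, Circle)) (z : Circle) (k : ℤ) :
    star (intertwiner b α f z : H →L[ℂ] H) (b k) = conj (intertwinerWeight α f z k : ℂ) • b k :=
  star_apply_of_apply_eq_smul (isStarNormal_of_unitary (SetLike.coe_mem _))
    (intertwiner_apply b α f z k)

lemma pointHom_anzai_genU (α θ : ℝ) (f : C(Circle, Circle)) (z : Circle) :
    pointHom b α z (anzai α θ f (genU α)) * intertwiner b α f z =
      intertwiner b α f z * pointHom b α (Circle.exp θ * z) (genU α) := by
  refine continuousLinearMap_ext_hilbertBasis b fun k => ?_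
  simp only [anzai_genU, map_smul, mul_apply_eq_comp, smul_apply, intertwiner_apply,
    pointHom_genU_apply, smul_smul, Circle.coe_mul]
  congr 1
  ring

lemma pointHom_anzai_genV (α θ : ℝ) (f : C(Circle, Circle)) (z : Circle) :
    pointHom b α z (anzai α θ f (genV α)) * intertwiner b α f z =
      intertwiner b α f z * pointHom b α (Circle.exp θ * z) (genV α) := by
  refine continuousLinearMap_ext_hilbertBasis b fun k => ?_
  simp only [anzai_genV, circleFun, map_mul, map_smul, mul_apply_eq_comp, intertwiner_apply,
    pointHom_genV_apply, pointHom_cfc_genU_apply b α z (continuousOn_circleExt f), circleExt_coe,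
    smul_smul, intertwinerWeight_add_one]
  rw [Circle.coe_mul, mul_comm]

lemma pointHom_anzai (α θ : ℝ) (f : C(Circle, Circle)) (z : Circle) (x : NCTorus.{u} α) :
    pointHom b α z (anzai α θ f x) = intertwiner b α f z * pointHom b α (Circle.exp θ * z) x *
      star (intertwiner b α f z : H →L[ℂ] H) :=
  apply_eq_conj_of_gen (φ := (pointHom b α z).comp (anzai α θ f : NCTorus.{u} α →⋆ₐ[ℂ] NCTorus α))
    (pointHom_anzai_genU b α θ f z) (pointHom_anzai_genV b α θ f z) x

end PointHom

/-! ### Strong continuity in the point -/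

lemma eq_top_of_genU_mem_of_genV_mem {α : ℝ} {S : StarSubalgebra ℂ (NCTorus.{u} α)}
    (hS : IsClosed (S : Set (NCTorus.{u} α))) (hU : genU α ∈ S) (hV : genV α ∈ S) : S = ⊤ := by
  have hle : ncTorus.{u} α ≤ S.map (ncTorus.{u} α).subtype := by
    refine StarSubalgebra.topologicalClosure_minimal (StarAlgebra.adjoin_le ?_)
      ((ncTorus_isClosed α).isClosedEmbedding_subtypeVal.isClosedMap _ hS)
    rintro _ (rfl | rfl)
    exacts [⟨genU α, hU, rfl⟩, ⟨genV α, hV, rfl⟩]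
  refine eq_top_iff.2 fun x _ => ?_
  obtain ⟨y, hy, hyx⟩ := hle x.2
  exact Subtype.ext hyx ▸ hy

section StrongContinuity

variable {X A H : Type*} [TopologicalSpace X] [CStarAlgebra A] [NormedAddCommGroup H]
  [InnerProductSpace ℂ H] [CompleteSpace H] (π : X → A →⋆ₐ[ℂ] (H →L[ℂ] H))

/-- The elements `a` for which both `a` and `a*` act jointly continuously under the family of
representations `π`; asking this of `a*` too makes them a *-algebra. -/
def strongContinuityAlgebra : StarSubalgebra ℂ A where
  carrier := {a | (Continuous fun p : X × H => π p.1 a p.2) ∧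
    Continuous fun p : X × H => π p.1 (star a) p.2}
  mul_mem' {a c} ha hc := by
    simp only [Set.mem_ofPred_eq, star_mul, map_mul, mul_apply_eq_comp]
    exact ⟨ha.1.comp (continuous_fst.prodMk hc.1), hc.2.comp (continuous_fst.prodMk ha.2)⟩
  add_mem' {a c} ha hc := by
    simp only [Set.mem_ofPred_eq, star_add, map_add, add_apply]
    exact ⟨ha.1.add hc.1, ha.2.add hc.2⟩
  algebraMap_mem' r := by
    have hr (r : ℂ) : Continuous fun p : X × H => π p.1 (algebraMap ℂ A r) p.2 := by
      simp only [Algebra.algebraMap_eq_smul_one, map_smul, map_one, smul_apply,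
        one_apply_eq_self]
      exact continuous_snd.const_smul r
    exact ⟨hr r, algebraMap_star_comm (A := A) r ▸ hr (star r)⟩
  star_mem' {a} ha := ⟨ha.2, (star_star a).symm ▸ ha.1⟩

lemma isClosed_setOf_continuous_apply :
    IsClosed {a : A | Continuous fun p : X × H => π p.1 a p.2} := by
  refine isClosed_of_closure_subset fun a ha => ?_
  refine continuous_of_locally_uniform_approx_of_continuousAt fun p s hs => ?_
  obtain ⟨ε, hε, hs⟩ := Metric.mem_uniformity_dist.1 hs
  obtain ⟨c, hc, hac⟩ := Metric.mem_closure_iff.1 ha (ε / (‖p.2‖ + 1)) (by positivity)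
  refine ⟨{q | ‖q.2‖ < ‖p.2‖ + 1}, continuous_snd.norm.continuousAt.eventually_lt_const
    (lt_add_one _), _, hc.continuousAt, fun q hq => hs ?_⟩
  rw [dist_eq_norm] at hac
  rw [dist_eq_norm, ← sub_apply, ← map_sub]
  calc ‖π q.1 (a - c) q.2‖ ≤ ‖a - c‖ * (‖p.2‖ + 1) :=
        ContinuousLinearMap.le_of_opNorm_le_of_le _
          (NonUnitalStarAlgHom.norm_apply_le (π q.1) _) (le_of_lt hq)
    _ < ε := (lt_div_iff₀ (by positivity)).1 hac

lemma isClosed_strongContinuityAlgebra : IsClosed (strongContinuityAlgebra π : Set A) :=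
  (isClosed_setOf_continuous_apply π).inter
    ((isClosed_setOf_continuous_apply π).preimage continuous_star)

end StrongContinuity

lemma continuous_coe_circle : Continuous fun z : Circle => (z : ℂ) := continuous_subtype_val

section Coeff

variable {H : Type u} [NormedAddCommGroup H] [InnerProductSpace ℂ H] [CompleteSpace H]
  (b : HilbertBasis ℤ ℂ H)

lemma pointHom_genU (α : ℝ) (z : Circle) :
    pointHom b α z (genU α) = (z : ℂ) • (weightedPerm b 1 (rotOrbit α) : H →L[ℂ] H) := by
  refine continuousLinearMap_ext_hilbertBasis b fun k => ?_
  rw [smul_apply, pointHom_genU_apply, weightedPerm_apply, smul_smul, mul_comm, Circle.coe_mul,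
    Equiv.Perm.one_apply]

lemma strongContinuityAlgebra_pointHom (α : ℝ) :
    strongContinuityAlgebra (pointHom b α) = ⊤ := by
  have hcont (T : H →L[ℂ] H) : Continuous fun p : Circle × H => T p.2 :=
    T.continuous.comp continuous_snd
  refine eq_top_of_genU_mem_of_genV_mem (isClosed_strongContinuityAlgebra _) ⟨?_, ?_⟩
    ⟨hcont (weightedPerm b (Equiv.addRight 1) 1), ?_⟩
  · simp only [pointHom_genU b α, smul_apply]
    exact (continuous_coe_circle.comp continuous_fst).smul (hcont _)
  · simp only [map_star, pointHom_genU b α, star_smul, smul_apply]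
    exact (continuous_coe_circle.comp continuous_fst).star.smul (hcont _)
  · simp only [map_star]
    exact hcont (star (weightedPerm b (Equiv.addRight 1) 1 : H →L[ℂ] H))

lemma continuous_pointHom_apply {α : ℝ} (x : NCTorus.{u} α) :
    Continuous fun p : Circle × H => pointHom b α p.1 x p.2 :=
  (show x ∈ strongContinuityAlgebra (pointHom b α) from
    strongContinuityAlgebra_pointHom b α ▸ StarSubalgebra.mem_top).1

/-- The `(i, j)` matrix coefficient of an element of `𝔸_α` in the representations `pointHom b α z`,
as a function of the point `z`. -/
def coeff {α : ℝ} (i j : ℤ) (x : NCTorus.{u} α) (z : Circle) : ℂ :=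
  inner ℂ (b i) (pointHom b α z x (b j))

lemma continuous_coeff {α : ℝ} (i j : ℤ) (x : NCTorus.{u} α) : Continuous (coeff b i j x) := by
  have h := ((continuous_pointHom_apply b x).comp (Continuous.prodMk_left (b j)))
  exact continuous_const.inner h

lemma coeff_star {α : ℝ} (i j : ℤ) (x : NCTorus.{u} α) (z : Circle) :
    coeff b i j (star x) z = conj (coeff b j i x z) := by
  rw [coeff, coeff, map_star, ContinuousLinearMap.star_eq_adjoint,
    ContinuousLinearMap.adjoint_inner_right, inner_conj_symm]

lemma coeff_anzai (α θ : ℝ) (f : C(Circle, Circle)) (i j : ℤ) (x : NCTorus.{u} α) (z : Circle) :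
    coeff b i j (anzai α θ f x) z = intertwinerWeight α f z i *
      conj (intertwinerWeight α f z j : ℂ) * coeff b i j x (Circle.exp θ * z) := by
  rw [coeff, coeff, pointHom_anzai, mul_apply_eq_comp, mul_apply_eq_comp, star_intertwiner_apply,
    map_smul, map_smul, inner_smul_right, ← ContinuousLinearMap.adjoint_inner_left,
    ← ContinuousLinearMap.star_eq_adjoint, star_intertwiner_apply, inner_smul_left,
    Complex.conj_conj]
  ring

lemma coeff_cfc_genU_mul_genV_zpow {α : ℝ} {F : ℂ → ℂ} (hF : ContinuousOn F (Metric.sphere 0 1))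
    (n i j : ℤ) (z : Circle) :
    coeff b i j (cfc F (genU α) * ((⟨genV α, genV_mem_unitary α⟩ ^ n : unitary (NCTorus.{u} α)) :
      NCTorus.{u} α)) z =
      if i = j + n then F (rotOrbit α i * z : Circle) else 0 := by
  rw [coeff, map_mul, mul_apply_eq_comp, pointHom_genV_zpow_apply, pointHom_cfc_genU_apply b α z hF,
    inner_smul_right, orthonormal_iff_ite.1 b.orthonormal]
  split_ifs with h
  · rw [h, mul_one]
  · rw [mul_zero]

end Coeff

/-! ### States given by unit vector fields -/

section FieldState

variable {X A H : Type*} [MeasurableSpace X] [CStarAlgebra A] [NormedAddCommGroup H]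
  [InnerProductSpace ℂ H] [CompleteSpace H] {π : X → A →⋆ₐ[ℂ] (H →L[ℂ] H)} {μ : Measure X}
  {ξ : X → H}

/-- A unit vector field `ξ` along a family of representations `π`, measurable in the sense that
all the fields `x ↦ π_x(a) ξ_x` are. -/
structure IsUnitField (π : X → A →⋆ₐ[ℂ] (H →L[ℂ] H)) (μ : Measure X) (ξ : X → H) : Prop where
  aestronglyMeasurable_apply : ∀ a, AEStronglyMeasurable (fun x => π x a (ξ x)) μ
  norm_eq_one : ∀ᵐ x ∂μ, ‖ξ x‖ = 1

lemma IsUnitField.aestronglyMeasurable (hξ : IsUnitField π μ ξ) : AEStronglyMeasurable ξ μ := by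
  simpa only [map_one, one_apply_eq_self] using hξ.aestronglyMeasurable_apply 1

lemma IsUnitField.integrable_inner [IsFiniteMeasure μ] (hξ : IsUnitField π μ ξ) (a : A) :
    Integrable (fun x => inner ℂ (ξ x) (π x a (ξ x))) μ := by
  refine .of_bound (hξ.aestronglyMeasurable.inner (hξ.aestronglyMeasurable_apply a)) ‖a‖ ?_
  filter_upwards [hξ.norm_eq_one] with x hx
  calc ‖inner ℂ (ξ x) (π x a (ξ x))‖ ≤ ‖ξ x‖ * (‖π x a‖ * ‖ξ x‖) :=
        (norm_inner_le_norm _ _).trans (by gcongr; exact (π x a).le_opNorm _)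
    _ ≤ ‖a‖ := by simpa only [hx, one_mul, mul_one] using NonUnitalStarAlgHom.norm_apply_le (π x) a

/-- The functional `a ↦ ∫ ⟪ξ_x, π_x(a) ξ_x⟫ dμ(x)`, a direct integral of vector states; it is a
state when `μ` is a probability measure. -/
def fieldState [IsFiniteMeasure μ] (hξ : IsUnitField π μ ξ) : A →ₗ[ℂ] ℂ where
  toFun a := ∫ x, inner ℂ (ξ x) (π x a (ξ x)) ∂μ
  map_add' a c := by
    simp only [map_add, add_apply, inner_add_right]
    exact integral_add (hξ.integrable_inner a) (hξ.integrable_inner c)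
  map_smul' r a := by
    simp only [map_smul, smul_apply, inner_smul_right, RingHom.id_apply, smul_eq_mul,
      integral_const_mul]

lemma fieldState_apply [IsFiniteMeasure μ] (hξ : IsUnitField π μ ξ) (a : A) :
    fieldState hξ a = ∫ x, inner ℂ (ξ x) (π x a (ξ x)) ∂μ := rfl

lemma fieldState_star_mul_self [IsFiniteMeasure μ] (hξ : IsUnitField π μ ξ) (a : A) :
    fieldState hξ (star a * a) = ((∫ x, ‖π x a (ξ x)‖ ^ 2 ∂μ : ℝ) : ℂ) := by
  rw [fieldState_apply, ← integral_complex_ofReal]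
  congr 1 with x
  rw [map_mul, map_star, mul_apply_eq_comp, ContinuousLinearMap.star_eq_adjoint,
    ContinuousLinearMap.adjoint_inner_right, inner_self_eq_norm_sq_to_K]
  push_cast
  rfl

lemma isState_fieldState [IsProbabilityMeasure μ] (hξ : IsUnitField π μ ξ) :
    IsState (fieldState hξ) where
  map_one := by
    rw [fieldState_apply, integral_congr_ae (g := fun _ => 1), integral_const, probReal_univ,
      one_smul]
    filter_upwards [hξ.norm_eq_one] with x hx
    rw [map_one, one_apply_eq_self, inner_self_eq_norm_sq_to_K, hx]
    simp
  nonneg a := by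
    rw [fieldState_star_mul_self]
    exact ⟨integral_nonneg fun x => sq_nonneg _, Complex.ofReal_im _⟩

lemma fieldState_map_of_covariant [IsFiniteMeasure μ] (hξ : IsUnitField π μ ξ) {T : X → X}
    (hT : MeasurePreserving T μ μ) {Φ : A → A} {W : X → H →L[ℂ] H}
    (hπ : ∀ x a, π x (Φ a) = W x * π (T x) a * star (W x))
    (hW : ∀ᵐ x ∂μ, star (W x) (ξ x) = ξ (T x)) (a : A) :
    fieldState hξ (Φ a) = fieldState hξ a := by
  have hmeas : AEStronglyMeasurable (fun x => inner ℂ (ξ x) (π x a (ξ x))) (μ.map T) :=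
    hT.map_eq.symm ▸ (hξ.integrable_inner a).aestronglyMeasurable
  calc fieldState hξ (Φ a) = ∫ x, inner ℂ (ξ (T x)) (π (T x) a (ξ (T x))) ∂μ := by
        refine integral_congr_ae ?_
        filter_upwards [hW] with x hx
        rw [hπ, mul_apply_eq_comp, mul_apply_eq_comp, hx, ← ContinuousLinearMap.adjoint_inner_left,
          ← ContinuousLinearMap.star_eq_adjoint, hx]
    _ = ∫ x, inner ℂ (ξ x) (π x a (ξ x)) ∂μ.map T := (integral_map hT.aemeasurable hmeas).symm
    _ = fieldState hξ a := by rw [hT.map_eq, fieldState_apply]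

end FieldState

/-! ### The cohomological equation over an ergodic transformation -/

section Cohomological

variable {X : Type*} [MeasurableSpace X] {μ : Measure X} {T : X → X} {u : X → Circle} {g : X → ℂ}
  {γ : X → Circle}

/-- `g` solves the cohomological equation `(g ∘ T) u = g` almost everywhere. Here `g` is a function,
so that the notion covers continuous and circle-valued solutions as well as `L²` classes. -/
def IsCohomologicalSolution (μ : Measure X) (T : X → X) (u : X → Circle) (g : X → ℂ) : Prop :=
  ∀ᵐ x ∂μ, g (T x) * u x = g x

lemma IsCohomologicalSolution.neg (hg : IsCohomologicalSolution μ T u g) :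
    IsCohomologicalSolution μ T u (-g) := by
  filter_upwards [hg] with x hx
  rw [Pi.neg_apply, Pi.neg_apply, neg_mul, hx]

lemma IsCohomologicalSolution.norm_ae_eq_const (hT : Ergodic T μ) (hgm : AEStronglyMeasurable g μ)
    (hg : IsCohomologicalSolution μ T u g) : ∃ r : ℝ, ∀ᵐ x ∂μ, ‖g x‖ = r := by
  refine hT.quasiErgodic.ae_eq_const_of_ae_eq_comp_ae hgm.norm ?_
  filter_upwards [hg] with x hx
  rw [Function.comp_apply, ← hx, norm_mul, Circle.norm_coe, mul_one]

lemma IsCohomologicalSolution.exists_circle (hT : Ergodic T μ) (hgm : AEStronglyMeasurable g μ)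
    (hg : IsCohomologicalSolution μ T u g) (hg0 : ¬ g =ᵐ[μ] 0) :
    ∃ γ : X → Circle, AEMeasurable γ μ ∧ IsCohomologicalSolution μ T u (fun x => γ x) ∧
      ∃ r : ℂ, g =ᵐ[μ] fun x => r * γ x := by
  obtain ⟨r, hr⟩ := hg.norm_ae_eq_const hT hgm
  have hpolar : ∀ᵐ x ∂μ, g x = r * Circle.exp (g x).arg := by
    filter_upwards [hr] with x hx
    rw [← hx, Circle.coe_exp, Complex.norm_mul_exp_arg_mul_I]
  have hr0 : (r : ℂ) ≠ 0 := by
    intro h0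
    refine hg0 (hpolar.mono fun x hx => ?_)
    rw [hx, h0, zero_mul, Pi.zero_apply]
  refine ⟨fun x => Circle.exp (g x).arg, ?_, ?_, r, hpolar⟩
  · exact (Circle.exp.continuous.measurable.comp Complex.measurable_arg).comp_aemeasurable
      hgm.aemeasurable
  · filter_upwards [hg, hpolar, hT.quasiMeasurePreserving.ae hpolar] with x hx hpx hpTx
    rw [hpTx, hpx, mul_assoc] at hx
    exact mul_left_cancel₀ hr0 hx

lemma IsCohomologicalSolution.exists_circle_not_continuous [TopologicalSpace X]
    (hT : Ergodic T μ) (hgm : AEStronglyMeasurable g μ) (hg : IsCohomologicalSolution μ T u g)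
    (hgc : ¬ ∃ k : C(X, ℂ), g =ᵐ[μ] k) :
    ∃ γ : X → Circle, AEMeasurable γ μ ∧ IsCohomologicalSolution μ T u (fun x => γ x) ∧
      ¬ ∃ k : C(X, ℂ), (fun x => (γ x : ℂ)) =ᵐ[μ] k := by
  obtain ⟨γ, hγm, hγ, r, hr⟩ := hg.exists_circle hT hgm fun h0 => hgc ⟨0, h0⟩
  refine ⟨γ, hγm, hγ, fun ⟨k, hk⟩ => hgc ⟨r • k, ?_⟩⟩
  filter_upwards [hr, hk] with x hrx hkx
  rw [hrx, hkx, ContinuousMap.coe_smul, Pi.smul_apply, smul_eq_mul]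

lemma IsCohomologicalSolution.ae_eq_const_mul (hT : Ergodic T μ) (hγm : AEMeasurable γ μ)
    (hγ : IsCohomologicalSolution μ T u (fun x => γ x)) (hgm : AEStronglyMeasurable g μ)
    (hg : IsCohomologicalSolution μ T u g) : ∃ c : ℂ, g =ᵐ[μ] fun x => c * γ x := by
  have hdiv : AEStronglyMeasurable (fun x => g x / γ x) μ :=
    (hgm.aemeasurable.div (continuous_coe_circle.measurable.comp_aemeasurable
      hγm)).aestronglyMeasurable
  obtain ⟨c, hc⟩ := hT.quasiErgodic.ae_eq_const_of_ae_eq_comp_ae hdiv (by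
    filter_upwards [hg, hγ] with x hx hγx
    rw [Function.comp_apply, ← hx, ← hγx, mul_div_mul_right _ _ (Circle.coe_ne_zero _)])
  refine ⟨c, hc.mono fun x hx => ?_⟩
  rw [← div_eq_iff (Circle.coe_ne_zero _)]
  exact hx

lemma IsCohomologicalSolution.continuous_ae_eq_zero [TopologicalSpace X] [OpensMeasurableSpace X]
    (hT : Ergodic T μ) (hγm : AEMeasurable γ μ)
    (hγ : IsCohomologicalSolution μ T u (fun x => γ x))
    (hγc : ¬ ∃ k : C(X, ℂ), (fun x => (γ x : ℂ)) =ᵐ[μ] k) (hgc : Continuous g)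
    (hg : IsCohomologicalSolution μ T u g) : g =ᵐ[μ] 0 := by
  obtain ⟨c, hc⟩ := hγ.ae_eq_const_mul hT hγm hgc.measurable.aestronglyMeasurable hg
  obtain rfl | hc0 := eq_or_ne c 0
  · exact hc.mono fun x hx => hx.trans (zero_mul _)
  · refine (hγc ⟨⟨fun x => c⁻¹ * g x, hgc.const_mul _⟩, hc.mono fun x hx => ?_⟩).elim
    rw [ContinuousMap.coe_mk, hx, inv_mul_cancel_left₀ hc0]

end Cohomological

instance : Measure.IsHaarMeasure circleHaar :=
  inferInstanceAs (Measure.IsHaarMeasure (Measure.haarMeasure ⊤))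

instance : IsProbabilityMeasure circleHaar := ⟨Measure.haarMeasure_self⟩

lemma ergodic_rotation {θ : ℝ} (hθ : Irrational (θ / (2 * Real.pi))) :
    Ergodic (fun z => Circle.exp θ * z) circleHaar := by
  have : Fact (0 < 2 * Real.pi) := ⟨Real.two_pi_pos⟩
  have hdense : DenseRange fun k : ℤ => AddCircle.homeomorphCircle' (k • (θ : AddCircle _)) :=
    AddCircle.homeomorphCircle'.surjective.denseRange.comp
      (AddCircle.denseRange_zsmul_coe_iff.2 hθ) AddCircle.homeomorphCircle'.continuous
  refine ergodic_mul_left_of_denseRange_zpow ?_ circleHaar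
  simpa only [← AddCircle.coe_zsmul, AddCircle.homeomorphCircle'_apply_mk, Circle.exp_zsmul]
    using hdense

lemma exists_integral_mul_conj_ne_zero {X : Type*} [TopologicalSpace X] [CompactSpace X]
    [NormalSpace X] [MeasurableSpace X] [BorelSpace X] {μ : Measure X} [IsFiniteMeasure μ]
    [μ.WeaklyRegular] {γ : X → ℂ} (hγ : MemLp γ 2 μ) (hγ0 : ¬ γ =ᵐ[μ] 0) :
    ∃ k : C(X, ℂ), ∫ x, k x * conj (γ x) ∂μ ≠ 0 := by
  by_contra! h
  refine hγ0 ((MemLp.toLp_eq_toLp_iff hγ MemLp.zero).1 ?_)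
  rw [MemLp.toLp_zero]
  have hdense := ContinuousMap.toLp_denseRange ℂ μ ℂ (p := 2) ENNReal.ofNat_ne_top
  refine hdense.eq_zero_of_inner_left ℂ fun k => ?_
  rw [L2.inner_def, ← h k]
  refine integral_congr_ae ?_
  filter_upwards [hγ.coeFn_toLp, ContinuousMap.coeFn_toLp μ (𝕜 := ℂ) (p := 2) k] with x hγx hkx
  rw [hγx, hkx, RCLike.inner_apply]

/-! ### Two invariant states -/

section PairState

variable {H : Type u} [NormedAddCommGroup H] [InnerProductSpace ℂ H]
  (b : HilbertBasis ℤ ℂ H) {α θ : ℝ} {f : C(Circle, Circle)} {n : ℤ} {γ : Circle → Circle}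

/-- The vector field `2^{-1/2} (b_0 + conj γ(z) b_{-n})`, which is covariant along the skew-product
when `γ` solves the cohomological equation for `f_n`. -/
def pairField (n : ℤ) (γ : Circle → Circle) (z : Circle) : H :=
  ((√2 : ℝ) : ℂ)⁻¹ • (b 0 + (((γ z)⁻¹ : Circle) : ℂ) • b (-n))

lemma inner_pairField (S : H →L[ℂ] H) (n : ℤ) (γ : Circle → Circle) (z : Circle) :
    inner ℂ (pairField b n γ z) (S (pairField b n γ z)) =
      2⁻¹ * (inner ℂ (b 0) (S (b 0)) + inner ℂ (b (-n)) (S (b (-n))) +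
        (inner ℂ (b 0) (S (b (-n))) * conj (γ z : ℂ) + inner ℂ (b (-n)) (S (b 0)) * γ z)) := by
  have hsqrt : (((√2 : ℝ) : ℂ)⁻¹) * ((√2 : ℝ) : ℂ)⁻¹ = 2⁻¹ := by
    rw [← mul_inv, ← Complex.ofReal_mul, Real.mul_self_sqrt two_pos.le, Complex.ofReal_ofNat]
  have hγ : (γ z : ℂ) * conj (γ z : ℂ) = 1 := by
    rw [← Circle.coe_inv_eq_conj, ← Circle.coe_mul, mul_inv_cancel, Circle.coe_one]
  simp only [pairField, map_smul, map_add, inner_smul_left, inner_smul_right, inner_add_left,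
    inner_add_right, Circle.coe_inv_eq_conj, Complex.conj_conj, map_inv₀, Complex.conj_ofReal]
  rw [← hsqrt]
  linear_combination (((√2 : ℝ) : ℂ)⁻¹ * ((√2 : ℝ) : ℂ)⁻¹ * inner ℂ (b (-n)) (S (b (-n)))) * hγ

lemma norm_pairField (hn : n ≠ 0) (γ : Circle → Circle) (z : Circle) :
    ‖pairField b n γ z‖ = 1 := by
  have h := inner_pairField b 1 n γ z
  simp only [one_apply_eq_self, orthonormal_iff_ite.1 b.orthonormal, zero_eq_neg, neg_eq_zero, hn,
    if_true, if_false, zero_mul, add_zero, one_add_one_eq_two, inv_mul_cancel_of_invertible,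
    inner_self_eq_norm_sq_to_K] at h
  rw [← pow_eq_one_iff_of_nonneg (norm_nonneg _) two_ne_zero]
  exact Complex.ofReal_injective (by push_cast; exact h)

lemma aestronglyMeasurable_pairField (n : ℤ) (hγ : AEMeasurable γ circleHaar) :
    AEStronglyMeasurable (pairField b n γ) circleHaar :=
  (((continuous_coe_circle.comp_aestronglyMeasurable
    hγ.inv.aestronglyMeasurable).smul_const (b (-n))).const_add (b 0)).const_smul _

variable [CompleteSpace H]

lemma isUnitField_pairField (hn : n ≠ 0) (hγ : AEMeasurable γ circleHaar) :
    IsUnitField (pointHom b α) circleHaar (pairField b n γ) where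
  aestronglyMeasurable_apply x :=
    (continuous_pointHom_apply b x).comp_aestronglyMeasurable
      (f := fun z => (z, pairField b n γ z))
      (aestronglyMeasurable_id.prodMk (aestronglyMeasurable_pairField b n hγ))
  norm_eq_one := .of_forall (norm_pairField b hn γ)

/-- The state of `𝔸_α` given by the vector field `pairField b n γ`. -/
def pairState (α : ℝ) (hn : n ≠ 0) (hγ : AEMeasurable γ circleHaar) : NCTorus.{u} α →ₗ[ℂ] ℂ :=
  fieldState (isUnitField_pairField b (α := α) hn hγ)

lemma star_intertwiner_pairField {z : Circle}
    (hz : γ (Circle.exp θ * z) * cocycle α f n z = γ z) :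
    star (intertwiner b α f z : H →L[ℂ] H) (pairField b n γ z) =
      pairField b n γ (Circle.exp θ * z) := by
  have hweight : intertwinerWeight α f z (-n) = (cocycle α f n z)⁻¹ := by
    rw [intertwinerWeight, neg_neg]
  rw [pairField, pairField, map_smul, map_add, map_smul, star_intertwiner_apply,
    star_intertwiner_apply, intertwinerWeight_zero, hweight, ← Circle.coe_inv_eq_conj,
    ← Circle.coe_inv_eq_conj, inv_inv, inv_one, Circle.coe_one, one_smul, smul_smul,
    ← Circle.coe_mul, ← hz, mul_inv, inv_mul_cancel_right]

lemma pairState_anzai (hn : n ≠ 0) (hγ : AEMeasurable γ circleHaar)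
    (hsol : IsCohomologicalSolution circleHaar (fun z => Circle.exp θ * z) (cocycle α f n)
      fun z => γ z)
    (x : NCTorus.{u} α) :
    pairState b α hn hγ (anzai α θ f x) = pairState b α hn hγ x := by
  have hW : ∀ᵐ z ∂circleHaar, star (intertwiner b α f z : H →L[ℂ] H) (pairField b n γ z) =
      pairField b n γ (Circle.exp θ * z) :=
    hsol.mono fun _ hz => star_intertwiner_pairField b (Circle.ext hz)
  exact fieldState_map_of_covariant (isUnitField_pairField b hn hγ)
    (measurePreserving_mul_left circleHaar (Circle.exp θ))
    (fun z x => pointHom_anzai b α θ f z x) hW x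

lemma pairState_sub_pairState_neg (hn : n ≠ 0) (hγ : AEMeasurable γ circleHaar)
    (hγ' : AEMeasurable (-γ) circleHaar) (x : NCTorus.{u} α) :
    pairState b α hn hγ x - pairState b α hn hγ' x =
      ∫ z, (coeff b 0 (-n) x z * conj (γ z : ℂ) + coeff b (-n) 0 x z * γ z) ∂circleHaar := by
  rw [pairState, pairState, fieldState_apply, fieldState_apply,
    ← integral_sub ((isUnitField_pairField b hn hγ).integrable_inner x)
      ((isUnitField_pairField b hn hγ').integrable_inner x)]
  congr 1 with z
  simp only [inner_pairField, coeff, Pi.neg_apply, Circle.coe_neg, map_neg]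
  ring

lemma isCohomologicalSolution_coeff {x : NCTorus.{u} α} (hx : anzai α θ f x = x) (n : ℤ) :
    IsCohomologicalSolution circleHaar (fun z => Circle.exp θ * z) (cocycle α f n)
      (coeff b 0 (-n) x) := by
  refine .of_forall fun z => ?_
  have h := coeff_anzai b α θ f 0 (-n) x z
  rw [hx, intertwinerWeight_zero, intertwinerWeight, neg_neg, ← Circle.coe_inv_eq_conj, inv_inv,
    Circle.coe_one, one_mul, mul_comm] at h
  exact h.symm

lemma coeff_ae_eq_zero_of_fixed (hθ : Irrational (θ / (2 * Real.pi)))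
    (hγ : AEMeasurable γ circleHaar)
    (hsol : IsCohomologicalSolution circleHaar (fun z => Circle.exp θ * z) (cocycle α f n)
      fun z => γ z)
    (hγc : ¬ ∃ k : C(Circle, ℂ), (fun z => (γ z : ℂ)) =ᵐ[circleHaar] k)
    {x : NCTorus.{u} α} (hx : anzai α θ f x = x) : coeff b 0 (-n) x =ᵐ[circleHaar] 0 :=
  hsol.continuous_ae_eq_zero (ergodic_rotation hθ) hγ hγc (continuous_coeff b 0 (-n) x)
    (isCohomologicalSolution_coeff b hx n)

lemma pairState_eq_pairState_neg_of_fixed (hθ : Irrational (θ / (2 * Real.pi))) (hn : n ≠ 0)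
    (hγ : AEMeasurable γ circleHaar) (hγ' : AEMeasurable (-γ) circleHaar)
    (hsol : IsCohomologicalSolution circleHaar (fun z => Circle.exp θ * z) (cocycle α f n)
      fun z => γ z)
    (hγc : ¬ ∃ k : C(Circle, ℂ), (fun z => (γ z : ℂ)) =ᵐ[circleHaar] k)
    {x : NCTorus.{u} α} (hx : anzai α θ f x = x) :
    pairState b α hn hγ x = pairState b α hn hγ' x := by
  rw [← sub_eq_zero, pairState_sub_pairState_neg]
  refine integral_eq_zero_of_ae ?_
  have hx' : anzai α θ f (star x) = star x := by rw [map_star, hx]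
  filter_upwards [coeff_ae_eq_zero_of_fixed b hθ hγ hsol hγc hx,
    coeff_ae_eq_zero_of_fixed b hθ hγ hsol hγc hx'] with z hxz hxz'
  rw [coeff_star, Pi.zero_apply, map_eq_zero] at hxz'
  rw [hxz, hxz', Pi.zero_apply, zero_mul, zero_mul, add_zero]

lemma exists_coeff_eq (hn : n ≠ 0) (k : C(Circle, ℂ)) :
    ∃ a : NCTorus.{u} α, ∀ z, coeff b 0 (-n) a z = k z ∧ coeff b (-n) 0 a z = 0 := by
  obtain ⟨F, hF⟩ := k.exists_extension
    (continuous_coe_circle.isClosedEmbedding Circle.coe_injective)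
  refine ⟨cfc F (genU α) * ((⟨genV α, genV_mem_unitary α⟩ ^ n : unitary (NCTorus.{u} α)) :
    NCTorus.{u} α), fun z => ⟨?_, ?_⟩⟩
  · rw [coeff_cfc_genU_mul_genV_zpow b F.continuous.continuousOn, if_pos (neg_add_cancel n).symm,
      rotOrbit_zero, one_mul]
    exact DFunLike.congr_fun hF z
  · rw [coeff_cfc_genU_mul_genV_zpow b F.continuous.continuousOn, if_neg (by omega)]

lemma exists_pairState_ne_pairState_neg (hn : n ≠ 0) (hγ : AEMeasurable γ circleHaar)
    (hγ' : AEMeasurable (-γ) circleHaar) :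
    ∃ a : NCTorus.{u} α, pairState b α hn hγ a ≠ pairState b α hn hγ' a := by
  have hL2 : MemLp (fun z => (γ z : ℂ)) 2 circleHaar :=
    .of_bound (continuous_coe_circle.comp_aestronglyMeasurable hγ.aestronglyMeasurable) 1
      (.of_forall fun z => (Circle.norm_coe _).le)
  have hne : ¬ (fun z => (γ z : ℂ)) =ᵐ[circleHaar] 0 := fun h =>
    h.exists.elim fun z => Circle.coe_ne_zero (γ z)
  obtain ⟨k, hk⟩ := exists_integral_mul_conj_ne_zero hL2 hne
  obtain ⟨a, ha⟩ := exists_coeff_eq (α := α) b hn k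
  refine ⟨a, sub_ne_zero.1 ?_⟩
  simpa only [pairState_sub_pairState_neg, (ha _).1, (ha _).2, zero_mul, add_zero] using hk

end PairState

lemma exists_hilbertBasis_int : ∃ (H : Type u) (_ : NormedAddCommGroup H)
    (_ : InnerProductSpace ℂ H) (_ : CompleteSpace H), Nonempty (HilbertBasis ℤ ℂ H) := by
  let b : HilbertBasis (ULift.{u} ℤ) ℂ (lp (fun _ : ULift.{u} ℤ => ℂ) 2) := default
  refine ⟨_, _, _, inferInstance,
    ⟨HilbertBasis.mk (b.orthonormal.comp ULift.up ULift.up_injective) ?_⟩⟩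
  rw [ULift.up_surjective.range_comp, b.dense_span]

theorem exists_invariant_states_ne {α θ : ℝ} (hθ : Irrational (θ / (2 * Real.pi)))
    {f : C(Circle, Circle)} {n : ℤ} (hn : n ≠ 0) {γ : Circle → Circle}
    (hγ : AEMeasurable γ circleHaar)
    (hsol : IsCohomologicalSolution circleHaar (fun z => Circle.exp θ * z) (cocycle α f n)
      fun z => γ z)
    (hγc : ¬ ∃ k : C(Circle, ℂ), (fun z => (γ z : ℂ)) =ᵐ[circleHaar] k) :
    ∃ φ₁ φ₂ : NCTorus.{u} α →ₗ[ℂ] ℂ, IsState φ₁ ∧ IsState φ₂ ∧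
      (∀ x, φ₁ (anzai α θ f x) = φ₁ x) ∧ (∀ x, φ₂ (anzai α θ f x) = φ₂ x) ∧
      (∀ x, anzai α θ f x = x → φ₁ x = φ₂ x) ∧ ∃ a, φ₁ a ≠ φ₂ a := by
  obtain ⟨H, _, _, _, ⟨b⟩⟩ := exists_hilbertBasis_int.{u}
  have hγ' : AEMeasurable (-γ) circleHaar := continuous_neg.measurable.comp_aemeasurable hγ
  have hsol' : IsCohomologicalSolution circleHaar (fun z => Circle.exp θ * z) (cocycle α f n)
      fun z => ((-γ) z : Circle) := by
    simpa only [Pi.neg_def, Circle.coe_neg] using hsol.neg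
  exact ⟨pairState b α hn hγ, pairState b α hn hγ', isState_fieldState _, isState_fieldState _,
    pairState_anzai b hn hγ hsol, pairState_anzai b hn hγ' hsol',
    fun _ => pairState_eq_pairState_neg_of_fixed b hθ hn hγ hγ' hsol hγc,
    exists_pairState_ne_pairState_neg b hn hγ hγ'⟩

end NCAnzai
end

theorem mainTheorem7 (α θ : ℝ) (hθ : Irrational (θ / (2 * Real.pi))) (f : C(Circle, Circle))
    (n : ℤ) (hn : n ≠ 0) (g : Lp ℂ 2 NCAnzai.circleHaar)
    (hg : NCAnzai.SolvesCohomological α θ f n g)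
    (hgc : ¬ ∃ c : C(Circle, ℂ), ⇑g =ᵐ[NCAnzai.circleHaar] ⇑c) :
    (∃ a : NCAnzai.NCTorus.{u} α, ¬ ∃ b : NCAnzai.NCTorus.{u} α,
      Filter.Tendsto
        (fun N : ℕ => toWeakSpace ℂ (NCAnzai.NCTorus.{u} α)
          (NCAnzai.cesaroMean (NCAnzai.anzai α θ f) a N))
        Filter.atTop (nhds (toWeakSpace ℂ (NCAnzai.NCTorus.{u} α) b))) ∧
    (¬ ∀ a : NCAnzai.NCTorus.{u} α, ∃ b : NCAnzai.NCTorus.{u} α,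
      Filter.Tendsto (NCAnzai.cesaroMean (NCAnzai.anzai α θ f) a) Filter.atTop (nhds b)) ∧
    ¬ NCAnzai.UniquelyErgodicRelFixed (NCAnzai.anzai.{u} α θ f) := by
  obtain ⟨γ, hγ, hsol, hγc⟩ := NCAnzai.IsCohomologicalSolution.exists_circle_not_continuous
    (NCAnzai.ergodic_rotation hθ) (Lp.aestronglyMeasurable g) hg hgc
  obtain ⟨φ₁, φ₂, h₁, h₂, hΦ₁, hΦ₂, hfix, a, ha⟩ :=
    NCAnzai.exists_invariant_states_ne.{u} hθ hn hγ hsol hγc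
  have hweak := NCAnzai.not_tendsto_toWeakSpace_cesaroMean_of_isState h₁ h₂ hΦ₁ hΦ₂ hfix ha
  refine ⟨⟨a, hweak⟩, fun hnorm => ?_, ?_⟩
  · obtain ⟨b, hb⟩ := hnorm a
    exact hweak ⟨b, NCAnzai.tendsto_toWeakSpace hb⟩
  · exact NCAnzai.not_uniquelyErgodicRelFixed h₁ h₂ hΦ₁ hΦ₂ hfix fun h => ha congr($h a)
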